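/- Let $e_{i,j}$, $i,j\ge 1$, be the matrix units in $\mathcal B(\ell_2)$, and let $R=\overline{\mathrm{span}}\{e_{1,j} : j\ge 1\}$ and $C=\overline{\mathrm{span}}\{e_{j,1} : j\ge 1\}$ be the row and the column operator space, so that $\mathrm M_n(R)$ and $\mathrm M_n(C)$ carry the norm of $\mathrm M_n(\mathcal B(\ell_2))=\mathcal B(\ell_2^{\oplus n})$. Regard $(R,C)$ as a compatible couple through the canonical linear isometries $R\to\ell_2$, $e_{1,j}\mapsto e_j$, and $C\to\ell_2$, $e_{j,1}\mapsto e_j$. For $\theta\in[0,1]$ let $(R,C)_\theta$ be the complex interpolation space, with the operator space structure given by $\mathrm M_n((R,C)_\theta)=(\mathrm M_n(R),\mathrm M_n(C))_\theta$ for all $n\ge 1$. For operator spaces $X$ and $Y$ we say that the bounded subsets of $X$ almost completely coarsely embed into $Y$ if there are maps $f^n\colon n\cdot B_X\to Y$, $n\ge 1$, where $B_X$ is the closed unit ball, such that the amplifications $$f^n_n\colon n\cdot B_{\mathrm M_n(X)}\to \mathrm M_n(Y),\qquad f^n_n([x_{ij}])=[f^n(x_{ij})],$$ are equi-coarse embeddings.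 This means that $$\omega(t)=\sup_n\sup\{\|f^n_n(x)-f^n_n(y)\|_{\mathrm M_n(Y)} : x,y\in n\cdot B_{\mathrm M_n(X)},\ \|x-y\|_{\mathrm M_n(X)}\le t\}$$ is finite for every $t\ge 0$, and that $$\rho(t)=\inf_n\inf\{\|f^n_n(x)-f^n_n(y)\|_{\mathrm M_n(Y)} : x,y\in n\cdot B_{\mathrm M_n(X)},\ \|x-y\|_{\mathrm M_n(X)}\ge t\}$$ tends to $\infty$ as $t\to\infty$ (with $\inf\emptyset=\infty$). Theorem. Let $\theta,\gamma\in[0,1]$ be distinct. Then the bounded subsets of $(R,C)_\theta$ do not almost completely coarsely embed into $(R,C)_\gamma$. -/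

import Mathlib

open Set Filter Topology
open scoped ENNReal ZeroAtInfty

noncomputable section

/-! ### Complex interpolation of a compatible couple -/

namespace ComplexInterpolation

variable {E₀ E₁ Z : Type*} [NormedAddCommGroup E₀] [NormedSpace ℂ E₀]
  [NormedAddCommGroup E₁] [NormedSpace ℂ E₁] [AddCommGroup Z] [Module ℂ Z]
  [TopologicalSpace Z] [IsTopologicalAddGroup Z] [T2Space Z]

/-- The map `(a, b) ↦ j₀ a + j₁ b` from the `ℓ¹`-sum of `E₀` and `E₁` to the ambient space `Z`. -/
def sumMap (j₀ : E₀ →L[ℂ] Z) (j₁ : E₁ →L[ℂ] Z) : WithLp 1 (E₀ × E₁) →L[ℂ] Z :=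
  (j₀.coprod j₁) ∘L (WithLp.prodContinuousLinearEquiv 1 ℂ E₀ E₁).toContinuousLinearMap

/-- The kernel of `(a, b) ↦ j₀ a + j₁ b`. -/
abbrev sumKer (j₀ : E₀ →L[ℂ] Z) (j₁ : E₁ →L[ℂ] Z) : Submodule ℂ (WithLp 1 (E₀ × E₁)) :=
  LinearMap.ker (sumMap j₀ j₁).toLinearMap

instance isClosed_sumKer (j₀ : E₀ →L[ℂ] Z) (j₁ : E₁ →L[ℂ] Z) :
    IsClosed (sumKer j₀ j₁ : Set (WithLp 1 (E₀ × E₁))) :=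
  (sumMap j₀ j₁).isClosed_ker

/-- For a compatible couple, given by continuous linear embeddings `j₀ : E₀ → Z` and
`j₁ : E₁ → Z` into a Hausdorff topological vector space, the sum `E₀ + E₁` inside `Z`, with its
usual norm `‖z‖ = inf {‖a‖ + ‖b‖ : j₀ a + j₁ b = z}` : the quotient of the `ℓ¹`-sum
`E₀ ⊕₁ E₁` by the kernel of `(a, b) ↦ j₀ a + j₁ b`. -/
abbrev SumSpace (j₀ : E₀ →L[ℂ] Z) (j₁ : E₁ →L[ℂ] Z) : Type _ :=
  WithLp 1 (E₀ × E₁) ⧸ sumKer j₀ j₁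

variable (j₀ : E₀ →L[ℂ] Z) (j₁ : E₁ →L[ℂ] Z)

/-- The inclusion `E₀ + E₁ → Z`. -/
def SumSpace.incl : SumSpace j₀ j₁ →ₗ[ℂ] Z :=
  (sumKer j₀ j₁).liftQ (sumMap j₀ j₁).toLinearMap le_rfl

/-- The inclusion `E₀ → E₀ + E₁`. -/
def SumSpace.inl : E₀ →ₗ[ℂ] SumSpace j₀ j₁ :=
  (sumKer j₀ j₁).mkQ ∘ₗ
    (WithLp.linearEquiv 1 ℂ (E₀ × E₁)).symm.toLinearMap ∘ₗ LinearMap.inl ℂ E₀ E₁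

/-- The inclusion `E₁ → E₀ + E₁`. -/
def SumSpace.inr : E₁ →ₗ[ℂ] SumSpace j₀ j₁ :=
  (sumKer j₀ j₁).mkQ ∘ₗ
    (WithLp.linearEquiv 1 ℂ (E₀ × E₁)).symm.toLinearMap ∘ₗ LinearMap.inr ℂ E₀ E₁

/-- Calderón's space `ℱ(E₀, E₁)` : functions `f` with values in `E₀ + E₁` that are bounded and
continuous on the strip `0 ≤ Re z ≤ 1` and holomorphic inside it, and whose boundary
values `t ↦ f (it)` and `t ↦ f (1 + it)` are continuous functions into `E₀`, respectively into
`E₁`, that vanish at infinity. An element is recorded as the function together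
with its two boundary functions. -/
structure IsCalderon (F : (ℂ → SumSpace j₀ j₁) × C₀(ℝ, E₀) × C₀(ℝ, E₁)) : Prop where
  continuousOn : ContinuousOn F.1 {z : ℂ | z.re ∈ Icc (0 : ℝ) 1}
  bounded : ∃ M : ℝ, ∀ z : ℂ, z.re ∈ Icc (0 : ℝ) 1 → ‖F.1 z‖ ≤ M
  differentiableOn : DifferentiableOn ℂ F.1 {z : ℂ | z.re ∈ Ioo (0 : ℝ) 1}
  left : ∀ t : ℝ, F.1 (t * Complex.I) = SumSpace.inl j₀ j₁ (F.2.1 t)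
  right : ∀ t : ℝ, F.1 (1 + t * Complex.I) = SumSpace.inr j₀ j₁ (F.2.2 t)

/-- `ℱ(E₀, E₁)` as a linear space. -/
def calderon : Submodule ℂ ((ℂ → SumSpace j₀ j₁) × C₀(ℝ, E₀) × C₀(ℝ, E₁)) where
  carrier := {F | IsCalderon j₀ j₁ F}
  zero_mem' :=
    { continuousOn := continuousOn_const
      bounded := ⟨0, fun z _ => by simp⟩
      differentiableOn := differentiableOn_const _
      left := fun t => by simp
      right := fun t => by simp }
  add_mem' := by
    rintro F G hF hG
    obtain ⟨M, hM⟩ := hF.bounded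
    obtain ⟨N, hN⟩ := hG.bounded
    exact
      { continuousOn := hF.continuousOn.add hG.continuousOn
        bounded := ⟨M + N, fun z hz => (norm_add_le _ _).trans (add_le_add (hM z hz) (hN z hz))⟩
        differentiableOn := hF.differentiableOn.add hG.differentiableOn
        left := fun t => by
          have h := hF.left t
          have h' := hG.left t
          simp [h, h']
        right := fun t => by
          have h := hF.right t
          have h' := hG.right t
          simp [h, h'] }
  smul_mem' := by
    rintro c F hF
    obtain ⟨M, hM⟩ := hF.bounded
    exact
      { continuousOn := hF.continuousOn.const_smul c
        bounded := ⟨‖c‖ * M, fun z hz => by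
          have := mul_le_mul_of_nonneg_left (hM z hz) (norm_nonneg c)
          exact (norm_smul_le c (F.1 z)).trans this⟩
        differentiableOn := hF.differentiableOn.const_smul c
        left := fun t => by
          have h := hF.left t
          simp [h]
        right := fun t => by
          have h := hF.right t
          simp [h] }

/-- Evaluation `f ↦ f (θ)` from `ℱ(E₀, E₁)` to `Z`. -/
def evalAt (θ : ℝ) : calderon j₀ j₁ →ₗ[ℂ] Z where
  toFun F := SumSpace.incl j₀ j₁ (F.1.1 θ)
  map_add' F G := by simp
  map_smul' c F := by simp

/-- The complex interpolation space `(E₀, E₁)_θ = {f (θ) : f ∈ ℱ(E₀, E₁)}`, a subspace of `Z`. -/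
def interpSpace (θ : ℝ) : Submodule ℂ Z := LinearMap.range (evalAt j₀ j₁ θ)

/-- The norm of `(E₀, E₁)_θ` :
`‖z‖ = inf {max (sup_t ‖f (it)‖₀) (sup_t ‖f (1 + it)‖₁) : f ∈ ℱ(E₀, E₁), f (θ) = z}`,
meaningful for `z ∈ interpSpace j₀ j₁ θ`. (The norm of `C₀(ℝ, E)` is the supremum norm.) -/
def interpNorm (θ : ℝ) (z : Z) : ℝ :=
  ⨅ F : {F : calderon j₀ j₁ // evalAt j₀ j₁ θ F = z}, max ‖F.1.1.2.1‖ ‖F.1.1.2.2‖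

end ComplexInterpolation

/-! ### Matrix norms and interpolation of operator spaces -/

namespace OperatorSpace

/-- The data of matrix norms on a space `V` : a function `‖·‖_{M_n(V)}` on `M_n(V)` for every
`n`. -/
abbrev MatrixNorms (V : Type*) : Type _ := (n : ℕ) → Matrix (Fin n) (Fin n) V → ℝ

section Concrete

variable {H : Type*} [NormedAddCommGroup H] [InnerProductSpace ℂ H]

variable (H) in
/-- The Hilbert space `H^{⊕n}`. -/
abbrev HilbertPow (n : ℕ) : Type _ := PiLp 2 (fun _ : Fin n => H)

/-- For a subspace `X` of `B(H)`, the space `M_n(X)` of matrices with entries in `X`, as a type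
of its own that carries the operator space norm defined below. -/
def OpMatrix (X : Submodule ℂ (H →L[ℂ] H)) (n : ℕ) : Type _ := Matrix (Fin n) (Fin n) X

variable {X : Submodule ℂ (H →L[ℂ] H)} {n : ℕ}

instance : AddCommGroup (OpMatrix X n) := inferInstanceAs (AddCommGroup (Matrix _ _ _))

instance : Module ℂ (OpMatrix X n) := inferInstanceAs (Module ℂ (Matrix _ _ _))

/-- The operator on `H^{⊕n}` with matrix `x` : `(x ξ)_i = ∑ j, x_ij ξ_j`. -/
def OpMatrix.toOperator : OpMatrix X n →ₗ[ℂ] (HilbertPow H n →L[ℂ] HilbertPow H n) where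
  toFun x :=
    (PiLp.continuousLinearEquiv 2 ℂ (fun _ : Fin n => H)).symm.toContinuousLinearMap ∘L
      ContinuousLinearMap.pi fun i =>
        ∑ j, (x i j).1 ∘L (PiLp.proj 2 (fun _ : Fin n => H) j : HilbertPow H n →L[ℂ] H)
  map_add' x y := by
    ext ξ i
    have h (j : Fin n) : ((x + y) i j).1 = (x i j).1 + (y i j).1 := rfl
    simp [h, Finset.sum_add_distrib]
  map_smul' c x := by
    ext ξ i
    have h (j : Fin n) : ((c • x) i j).1 = c • (x i j).1 := rfl
    simp [h, Finset.smul_sum]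

theorem OpMatrix.toOperator_apply (x : OpMatrix X n) (ξ : HilbertPow H n) (i : Fin n) :
    OpMatrix.toOperator x ξ i = ∑ j, (x i j).1 (ξ j) := by
  simp [OpMatrix.toOperator]

theorem OpMatrix.toOperator_single (x : OpMatrix X n) (i j : Fin n) (h : H) :
    OpMatrix.toOperator x (PiLp.single 2 j h) i = (x i j).1 h := by
  rw [OpMatrix.toOperator_apply, Finset.sum_eq_single j]
  · simp
  · intro k _ hk
    rw [PiLp.single_eq_of_ne 2 hk, map_zero]
  · simp

theorem OpMatrix.toOperator_injective :
    Function.Injective (OpMatrix.toOperator (X := X) (n := n)) := by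
  intro x y hxy
  refine Matrix.ext fun i j => Subtype.ext (ContinuousLinearMap.ext fun h => ?_)
  rw [← OpMatrix.toOperator_single x i j h, ← OpMatrix.toOperator_single y i j h, hxy]

/-- The norm of `M_n(X)` is the operator norm of `B(H^{⊕n})`. -/
instance : NormedAddCommGroup (OpMatrix X n) :=
  NormedAddCommGroup.induced (OpMatrix X n) (HilbertPow H n →L[ℂ] HilbertPow H n)
    OpMatrix.toOperator OpMatrix.toOperator_injective

instance : NormedSpace ℂ (OpMatrix X n) :=
  NormedSpace.induced ℂ (OpMatrix X n) (HilbertPow H n →L[ℂ] HilbertPow H n)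
    OpMatrix.toOperator

theorem OpMatrix.norm_def (x : OpMatrix X n) : ‖x‖ = ‖OpMatrix.toOperator x‖ := rfl

theorem OpMatrix.norm_entry_le (x : OpMatrix X n) (i j : Fin n) : ‖x i j‖ ≤ ‖x‖ := by
  refine ContinuousLinearMap.opNorm_le_bound (x i j).1 (norm_nonneg x) fun h => ?_
  have h₁ := PiLp.norm_apply_le (OpMatrix.toOperator x (PiLp.single 2 j h)) i
  have h₂ := ContinuousLinearMap.le_opNorm (OpMatrix.toOperator x) (PiLp.single 2 j h)
  rw [OpMatrix.toOperator_single] at h₁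
  rw [PiLp.norm_single] at h₂
  exact h₁.trans h₂

theorem OpMatrix.continuous_entry (i j : Fin n) : Continuous fun x : OpMatrix X n => x i j :=
  (LinearMap.mkContinuous
    ({ toFun := fun x => x i j, map_add' := fun _ _ => rfl, map_smul' := fun _ _ => rfl } :
      OpMatrix X n →ₗ[ℂ] X) 1 fun x => by
        rw [one_mul]
        exact OpMatrix.norm_entry_le x i j).continuous

/-- The amplification `M_n(X) → M_n(Z)`, `[x_ij] ↦ [u x_ij]`, of a linear map `u : X → Z`. -/
def OpMatrix.amplify {Z : Type*} [AddCommGroup Z] [Module ℂ Z] [TopologicalSpace Z]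
    (u : X →L[ℂ] Z) (n : ℕ) : OpMatrix X n →L[ℂ] Matrix (Fin n) (Fin n) Z where
  toFun x := Matrix.of fun i j => u (x i j)
  map_add' x y := by
    ext i j
    exact map_add u (x i j) (y i j)
  map_smul' c x := by
    ext i j
    exact map_smul u c (x i j)
  cont := continuous_matrix fun i j => u.continuous.comp (OpMatrix.continuous_entry i j)

end Concrete

section Interpolation

variable {H K Z : Type*} [NormedAddCommGroup H] [InnerProductSpace ℂ H]
  [NormedAddCommGroup K] [InnerProductSpace ℂ K] [AddCommGroup Z] [Module ℂ Z]
  [TopologicalSpace Z] [IsTopologicalAddGroup Z] [T2Space Z]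
  {X : Submodule ℂ (H →L[ℂ] H)} {Y : Submodule ℂ (K →L[ℂ] K)}

/-- The matrix norms of the interpolation operator space `(X, Y)_θ`, given by
`M_n((X, Y)_θ) = (M_n(X), M_n(Y))_θ`. The couple is made compatible by the embeddings
`jX : X → Z` and `jY : Y → Z`. -/
def interpMatrixNorms (jX : X →L[ℂ] Z) (jY : Y →L[ℂ] Z) (θ : ℝ) :
    MatrixNorms (ComplexInterpolation.interpSpace (E₀ := X) (E₁ := Y) jX jY θ) :=
  fun n x => ComplexInterpolation.interpNorm (OpMatrix.amplify jX n) (OpMatrix.amplify jY n) θ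
    (x.map fun z => (z : Z))

end Interpolation

/-! ### The row and column spaces -/

/-- The Hilbert space `ℓ₂`. -/
abbrev Ell2 : Type := lp (fun _ : ℕ => ℂ) 2

/-- The standard unit basis of `ℓ₂` (indexed from `0`). -/
def basisVec (j : ℕ) : Ell2 := lp.single 2 j (1 : ℂ)

/-- The matrix unit `e_{i,j}` in `B(ℓ₂)`, that is `ξ ↦ ξ_j e_i`. -/
def matUnit (i j : ℕ) : Ell2 →L[ℂ] Ell2 :=
  InnerProductSpace.rankOne ℂ (basisVec i) (basisVec j)

/-- The row operator space, the closed span of the first-row matrix units. -/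
def rowSpace : Submodule ℂ (Ell2 →L[ℂ] Ell2) :=
  (Submodule.span ℂ (range fun j : ℕ => matUnit 0 j)).topologicalClosure

/-- The column operator space, the closed span of the first-column matrix units. -/
def colSpace : Submodule ℂ (Ell2 →L[ℂ] Ell2) :=
  (Submodule.span ℂ (range fun j : ℕ => matUnit j 0)).topologicalClosure

/-- The canonical isometry `R → ℓ₂` that sends the `j`-th first-row matrix unit to the `j`-th
basis vector : it reads off the first row of `T`, which is the coordinatewise conjugate of
the first column of `T*`. -/
def rowEmb : rowSpace →L[ℂ] Ell2 where
  toFun T := star (ContinuousLinearMap.adjoint T.1 (basisVec 0))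
  map_add' S T := by simp
  map_smul' c T := by
    simp only [Submodule.coe_smul, map_smulₛₗ, _root_.smul_apply, star_smul]
    simp
  cont := by
    have h : Continuous fun T : rowSpace => ContinuousLinearMap.adjoint T.1 (basisVec 0) :=
      (ContinuousLinearMap.adjoint.continuous.comp continuous_subtype_val).clm_apply
        continuous_const
    exact continuous_star.comp h

/-- The canonical isometry `C → ℓ₂` that sends the `j`-th first-column matrix unit to the `j`-th
basis vector : it reads off the first column of `T`. -/
def colEmb : colSpace →L[ℂ] Ell2 where
  toFun T := T.1 (basisVec 0)
  map_add' S T := by simp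
  map_smul' c T := by simp
  cont := continuous_subtype_val.clm_apply continuous_const

/-- The underlying linear space of `(R, C)_θ`, a subspace of `ℓ₂`. -/
abbrev RC (θ : ℝ) : Submodule ℂ Ell2 :=
  ComplexInterpolation.interpSpace (E₀ := rowSpace) (E₁ := colSpace) rowEmb colEmb θ

/-- The operator space structure of `(R, C)_θ`. -/
def rcNorms (θ : ℝ) : MatrixNorms (RC θ) := interpMatrixNorms rowEmb colEmb θ

end OperatorSpace

/-! ### Coarse notions -/

namespace Coarse

variable {ι : Type*} {A B : ι → Type*}

/-- The modulus `ω(t) = sup_i sup {d(f_i x, f_i y) : x, y ∈ S_i, d(x, y) ≤ t}` in `[0, ∞]` of a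
family of maps `f_i` on sets `S_i`, for given distances on the domains and the targets. -/
def expansionModulus (dA : ∀ i, A i → A i → ℝ) (dB : ∀ i, B i → B i → ℝ)
    (S : ∀ i, Set (A i)) (f : ∀ i, A i → B i) (t : ℝ) : ℝ≥0∞ :=
  ⨆ (i : ι) (x ∈ S i) (y ∈ S i) (_ : dA i x y ≤ t), ENNReal.ofReal (dB i (f i x) (f i y))

/-- The modulus `ρ(t) = inf_i inf {d(f_i x, f_i y) : x, y ∈ S_i, d(x, y) ≥ t}` in `[0, ∞]`, where
the infimum of the empty set is `∞`. -/
def compressionModulus (dA : ∀ i, A i → A i → ℝ) (dB : ∀ i, B i → B i → ℝ)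
    (S : ∀ i, Set (A i)) (f : ∀ i, A i → B i) (t : ℝ) : ℝ≥0∞ :=
  ⨅ (i : ι) (x ∈ S i) (y ∈ S i) (_ : t ≤ dA i x y), ENNReal.ofReal (dB i (f i x) (f i y))

/-- The family `(f_i : S_i → B_i)` is an equi-coarse embedding : it is equi-coarse and
equi-expanding. -/
def IsEquiCoarseEmbedding (dA : ∀ i, A i → A i → ℝ) (dB : ∀ i, B i → B i → ℝ)
    (S : ∀ i, Set (A i)) (f : ∀ i, A i → B i) : Prop :=
  (∀ t : ℝ, 0 ≤ t → expansionModulus dA dB S f t < ∞) ∧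
    Tendsto (compressionModulus dA dB S f) atTop (𝓝 ∞)

end Coarse

namespace OperatorSpace

/-- The bounded subsets of `V` almost completely coarsely embed into `W` : there are maps
`f^n : n · B_V → W`, `n ≥ 1`, such that the amplifications
`f^n_n : n · B_{M_n(V)} → M_n(W)`, `[x_ij] ↦ [f^n (x_ij)]`, are equi-coarse embeddings.
As `n · B_{M_n(V)} ⊆ M_n(n · B_V)`, only the values of `f^n` on `n · B_V` matter, so `f^n` is
taken, equivalently, to be an arbitrary map on all of `V`. -/
def BoundedSubsetsAlmostCompletelyCoarselyEmbed {V W : Type*} [AddCommGroup V] [AddCommGroup W]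
    (NV : MatrixNorms V) (NW : MatrixNorms W) : Prop :=
  ∃ f : ℕ+ → V → W,
    Coarse.IsEquiCoarseEmbedding (ι := ℕ+)
      (A := fun n => Matrix (Fin n) (Fin n) V) (B := fun n => Matrix (Fin n) (Fin n) W)
      (fun n x y => NV n (x - y)) (fun n x y => NW n (x - y))
      (fun n => {x | NV n x ≤ (n : ℝ)})
      (fun n x => x.map (f n))

end OperatorSpace

end

/-! The obstruction is the growth of a column, or of a row, filled with `n` distinct basis vectors.
Such a column has norm at most `1` in `M_n(R)` and at most `√n` in `M_n(C)`, so interpolation gives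
at most a constant times `√n ^ θ` in `M_n((R, C)_θ)`; for a row the exponent is `1 - θ`. Conversely,
any matrix with one column whose entries all have norm at least `1` has norm at least `√n ^ γ` in
`M_n((R, C)_γ)`, and at least `√n ^ (1 - γ)` if this happens in a row. Orthogonality of the entries
plays no role in the lower bounds, so they apply to images under nonlinear maps.

Suppose that maps `f^n` were given. Scaling the column up from `0` until its entries have norm `t`
takes about `t √n ^ θ` steps of norm at most `1`, and each step moves the image by a bounded amount.
Testing on matrices with one non-zero entry shows that, for `t` large, `f^n` moves vectors of norm
`t` at least `1` away from the image of `0`. Hence `√n ^ γ ≲ √n ^ θ`, which is impossible for large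
`n` if `θ < γ`. If `γ < θ`, rows do the same, because `1 - θ < 1 - γ`.

The upper bounds rest on `exists_calderon`, which costs a harmless factor `e`. The lower bounds rest
on `norm_le_interpNorm` (three lines theorem) applied to the pairing of a matrix with its own column
or row. The path argument is `not_embed_of_growth`. -/

noncomputable section

set_option linter.unusedSectionVars false

/-! ### Upper and lower estimates for complex interpolation norms -/

namespace ComplexInterpolation

variable {E₀ E₁ Z : Type*} [NormedAddCommGroup E₀] [NormedSpace ℂ E₀]
  [NormedAddCommGroup E₁] [NormedSpace ℂ E₁] [AddCommGroup Z] [Module ℂ Z]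
  [TopologicalSpace Z] [IsTopologicalAddGroup Z] [T2Space Z]
  (j₀ : E₀ →L[ℂ] Z) (j₁ : E₁ →L[ℂ] Z)

theorem SumSpace.continuous_incl : Continuous (SumSpace.incl j₀ j₁) :=
  (sumKer j₀ j₁).isOpenQuotientMap_mkQ.isQuotientMap.continuous_iff.2 (sumMap j₀ j₁).continuous

@[simp]
theorem SumSpace.incl_inl (a : E₀) : SumSpace.incl j₀ j₁ (SumSpace.inl j₀ j₁ a) = j₀ a := by
  simp [SumSpace.incl, SumSpace.inl, sumMap]

@[simp]
theorem SumSpace.incl_inr (b : E₁) : SumSpace.incl j₀ j₁ (SumSpace.inr j₀ j₁ b) = j₁ b := by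
  simp [SumSpace.incl, SumSpace.inr, sumMap]

theorem SumSpace.incl_injective : Function.Injective (SumSpace.incl j₀ j₁) := by
  rw [← LinearMap.ker_eq_bot]
  exact Submodule.ker_liftQ_eq_bot' _ _ rfl

/-- The function `t ↦ g t • a` as an element of `C₀(ℝ, E)`. -/
def c0Smul {E : Type*} [NormedAddCommGroup E] [NormedSpace ℂ E] (g : ℝ → ℂ) (hg : Continuous g)
    (h0 : Tendsto g (cocompact ℝ) (𝓝 0)) (a : E) : C₀(ℝ, E) where
  toFun t := g t • a
  continuous_toFun := hg.smul continuous_const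
  zero_at_infty' := by simpa using h0.smul_const a

theorem norm_c0Smul_le {E : Type*} [NormedAddCommGroup E] [NormedSpace ℂ E] (g : ℝ → ℂ)
    (hg : Continuous g) (h0 : Tendsto g (cocompact ℝ) (𝓝 0)) (a : E) {M : ℝ} (hM : 0 ≤ M)
    (h : ∀ t, ‖g t‖ ≤ M) : ‖c0Smul g hg h0 a‖ ≤ M * ‖a‖ := by
  rw [← ZeroAtInftyContinuousMap.norm_toBCF_eq_norm]
  refine (BoundedContinuousFunction.norm_le (by positivity)).2 fun t => ?_
  exact (norm_smul_le _ _).trans (mul_le_mul_of_nonneg_right (h t) (norm_nonneg a))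

/-- The holomorphic multiplier `exp (z² - θ² + s (z - θ))`. -/
def gaussMul (θ s : ℝ) (z : ℂ) : ℂ := Complex.exp (z ^ 2 - θ ^ 2 + s * (z - θ))

theorem differentiable_gaussMul (θ s : ℝ) : Differentiable ℂ (gaussMul θ s) := by
  unfold gaussMul
  fun_prop

theorem norm_gaussMul (θ s : ℝ) (z : ℂ) :
    ‖gaussMul θ s z‖ = Real.exp (z.re ^ 2 - z.im ^ 2 - θ ^ 2 + s * (z.re - θ)) := by
  rw [gaussMul, Complex.norm_exp]
  congr 1
  simp [pow_two]

theorem norm_gaussMul_le (θ s : ℝ) (z : ℂ) :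
    ‖gaussMul θ s z‖ ≤ Real.exp (z.re ^ 2 + s * (z.re - θ)) := by
  rw [norm_gaussMul]
  exact Real.exp_le_exp.2 (by nlinarith [sq_nonneg z.im, sq_nonneg θ])

theorem tendsto_gaussMul (θ s r : ℝ) :
    Tendsto (fun t : ℝ => gaussMul θ s (r + t * Complex.I)) (cocompact ℝ) (𝓝 0) := by
  rw [tendsto_zero_iff_norm_tendsto_zero]
  have h (t : ℝ) : ‖gaussMul θ s (r + t * Complex.I)‖
      = Real.exp (r ^ 2 - θ ^ 2 + s * (r - θ) - t ^ 2) := by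
    rw [norm_gaussMul]
    congr 1
    simp
    ring
  simp_rw [h]
  refine Real.tendsto_exp_atBot.comp (tendsto_atBot_add_const_left _ _ ?_)
  refine tendsto_neg_atTop_atBot.comp ?_
  have := (tendsto_pow_atTop (α := ℝ) two_ne_zero).comp (tendsto_norm_cocompact_atTop (E := ℝ))
  simpa [Function.comp_def] using this

variable {j₀ j₁}

/-- A vector that lies in both spaces of the couple is the value at `θ` of an element of
Calderón's space with prescribed growth. -/
theorem exists_calderon {a : E₀} {b : E₁} (hab : j₀ a = j₁ b) (θ s : ℝ) :
    ∃ F : calderon j₀ j₁, evalAt j₀ j₁ θ F = j₀ a ∧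
      ‖F.1.2.1‖ ≤ Real.exp (-(s * θ)) * ‖a‖ ∧ ‖F.1.2.2‖ ≤ Real.exp (1 + s * (1 - θ)) * ‖b‖ := by
  have hg := (differentiable_gaussMul θ s).continuous
  have hline (r : ℝ) : Continuous fun t : ℝ => gaussMul θ s (r + t * Complex.I) :=
    hg.comp (by fun_prop)
  let F₀ : C₀(ℝ, E₀) := c0Smul _ (hline 0) (tendsto_gaussMul θ s 0) a
  let F₁ : C₀(ℝ, E₁) := c0Smul _ (hline 1) (tendsto_gaussMul θ s 1) b
  have hinlr : SumSpace.inl j₀ j₁ a = SumSpace.inr j₀ j₁ b :=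
    SumSpace.incl_injective j₀ j₁ (by simpa using hab)
  -- A scalar multiplier equal to `1` at `θ` times a fixed vector. The factor `exp (z² - θ²)` forces
  -- decay along vertical lines and costs at most `e` on the strip; the factor with `s` shifts
  -- weight between the two boundary lines.
  have hF : IsCalderon j₀ j₁ (fun z => gaussMul θ s z • SumSpace.inl j₀ j₁ a, F₀, F₁) :=
    { continuousOn := ((differentiable_gaussMul θ s).differentiableOn.smul_const
        (SumSpace.inl j₀ j₁ a)).continuousOn
      bounded := by
        refine ⟨Real.exp (1 + |s| * (1 + |θ|)) * ‖SumSpace.inl j₀ j₁ a‖, fun z hz => ?_⟩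
        refine (norm_smul_le _ _).trans (mul_le_mul_of_nonneg_right ?_
          (norm_nonneg (SumSpace.inl j₀ j₁ a)))
        refine (norm_gaussMul_le θ s z).trans (Real.exp_le_exp.2 (add_le_add ?_ ?_))
        · exact pow_le_one₀ hz.1 hz.2
        · refine (le_abs_self _).trans ?_
          rw [abs_mul]
          refine mul_le_mul_of_nonneg_left ?_ (abs_nonneg s)
          refine (abs_sub _ _).trans (add_le_add_left ?_ _)
          rw [abs_of_nonneg hz.1]
          exact hz.2
      differentiableOn :=
        (differentiable_gaussMul θ s).differentiableOn.smul_const (SumSpace.inl j₀ j₁ a)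
      left := fun t => by
        have : F₀ t = gaussMul θ s ((0 : ℝ) + t * Complex.I) • a := rfl
        simp [this]
      right := fun t => by
        have : F₁ t = gaussMul θ s ((1 : ℝ) + t * Complex.I) • b := rfl
        simp [this, hinlr] }
  refine ⟨⟨_, hF⟩, ?_, ?_, ?_⟩
  · simp [evalAt, gaussMul]
  · refine norm_c0Smul_le _ (hline 0) (tendsto_gaussMul θ s 0) a (Real.exp_nonneg _) fun t => ?_
    refine (norm_gaussMul_le _ _ _).trans (Real.exp_le_exp.2 ?_)
    simp
  · refine norm_c0Smul_le _ (hline 1) (tendsto_gaussMul θ s 1) b (Real.exp_nonneg _) fun t => ?_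
    refine (norm_gaussMul_le _ _ _).trans (Real.exp_le_exp.2 ?_)
    simp

theorem mem_interpSpace_of_eq {a : E₀} {b : E₁} (hab : j₀ a = j₁ b) (θ : ℝ) :
    j₀ a ∈ interpSpace j₀ j₁ θ := by
  obtain ⟨F, hF, -⟩ := exists_calderon hab θ 0
  exact ⟨F, hF⟩

theorem interpNorm_le {θ : ℝ} {z : Z} (F : calderon j₀ j₁) (hF : evalAt j₀ j₁ θ F = z) :
    interpNorm j₀ j₁ θ z ≤ max ‖F.1.2.1‖ ‖F.1.2.2‖ := by
  refine ciInf_le (f := fun F : {F : calderon j₀ j₁ // evalAt j₀ j₁ θ F = z} =>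
    max ‖F.1.1.2.1‖ ‖F.1.1.2.2‖) ⟨0, ?_⟩ ⟨F, hF⟩
  rintro _ ⟨G, rfl⟩
  exact le_max_of_le_left (norm_nonneg _)

theorem le_interpNorm {θ : ℝ} {z : Z} (hz : z ∈ interpSpace j₀ j₁ θ) {M : ℝ}
    (h : ∀ F : calderon j₀ j₁, evalAt j₀ j₁ θ F = z → M ≤ max ‖F.1.2.1‖ ‖F.1.2.2‖) :
    M ≤ interpNorm j₀ j₁ θ z := by
  obtain ⟨F, hF⟩ := hz
  have : Nonempty {F : calderon j₀ j₁ // evalAt j₀ j₁ θ F = z} := ⟨⟨F, hF⟩⟩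
  exact le_ciInf fun G => h G.1 G.2

theorem interpNorm_le_of_eq {a : E₀} {b : E₁} (hab : j₀ a = j₁ b) (θ s : ℝ) {M : ℝ}
    (h₀ : Real.exp (-(s * θ)) * ‖a‖ ≤ M) (h₁ : Real.exp (s * (1 - θ)) * ‖b‖ ≤ M) :
    interpNorm j₀ j₁ θ (j₀ a) ≤ Real.exp 1 * M := by
  obtain ⟨F, hF, hF₀, hF₁⟩ := exists_calderon hab θ s
  have hM : 0 ≤ M := le_trans (by positivity) h₀
  refine (interpNorm_le F hF).trans (max_le ?_ ?_)
  · exact (hF₀.trans h₀).trans (le_mul_of_one_le_left hM (Real.one_le_exp zero_le_one))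
  · refine hF₁.trans ?_
    rw [Real.exp_add, mul_assoc]
    exact mul_le_mul_of_nonneg_left h₁ (Real.exp_nonneg _)

/-- The choice `s = log M₀ - log M₁` balances the two boundary bounds: both become `K M₀ ^ (1 - θ)
M₁ ^ θ`. -/
theorem interpNorm_le_of_norm_le {a : E₀} {b : E₁} (hab : j₀ a = j₁ b) (θ : ℝ) {K M₀ M₁ : ℝ}
    (hM₀ : 0 < M₀) (hM₁ : 0 < M₁) (h₀ : ‖a‖ ≤ K * M₀) (h₁ : ‖b‖ ≤ K * M₁) :
    interpNorm j₀ j₁ θ (j₀ a) ≤ Real.exp 1 * (K * (M₀ ^ (1 - θ) * M₁ ^ θ)) := by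
  refine interpNorm_le_of_eq hab θ (Real.log M₀ - Real.log M₁) ?_ ?_
  · refine (mul_le_mul_of_nonneg_left h₀ (Real.exp_nonneg _)).trans (le_of_eq ?_)
    nth_rewrite 2 [← Real.exp_log hM₀]
    rw [Real.rpow_def_of_pos hM₀, Real.rpow_def_of_pos hM₁, ← Real.exp_add, mul_left_comm,
      ← Real.exp_add]
    ring_nf
  · refine (mul_le_mul_of_nonneg_left h₁ (Real.exp_nonneg _)).trans (le_of_eq ?_)
    nth_rewrite 2 [← Real.exp_log hM₁]
    rw [Real.rpow_def_of_pos hM₀, Real.rpow_def_of_pos hM₁, ← Real.exp_add, mul_left_comm,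
      ← Real.exp_add]
    ring_nf

theorem interpNorm_add_le {θ : ℝ} {x y : Z} (hx : x ∈ interpSpace j₀ j₁ θ)
    (hy : y ∈ interpSpace j₀ j₁ θ) :
    interpNorm j₀ j₁ θ (x + y) ≤ interpNorm j₀ j₁ θ x + interpNorm j₀ j₁ θ y := by
  rw [← sub_le_iff_le_add]
  refine le_interpNorm hx fun F hF => ?_
  rw [sub_le_comm]
  refine le_interpNorm hy fun G hG => ?_
  rw [sub_le_iff_le_add']
  refine (interpNorm_le (F + G) (by rw [map_add, hF, hG])).trans (max_le ?_ ?_)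
  · exact (norm_add_le F.1.2.1 G.1.2.1).trans (add_le_add (le_max_left _ _) (le_max_left _ _))
  · exact (norm_add_le F.1.2.2 G.1.2.2).trans (add_le_add (le_max_right _ _) (le_max_right _ _))

theorem interpNorm_zero_le (θ : ℝ) : interpNorm j₀ j₁ θ 0 ≤ 0 :=
  (interpNorm_le 0 (map_zero _)).trans (by simp)

/-- A functional that is bounded by `M₀` on `E₀` and by `M₁` on `E₁` is bounded by
`M₀ ^ (1 - θ) * M₁ ^ θ` on `(E₀, E₁)_θ`. -/
theorem norm_le_interpNorm {θ : ℝ} (hθ : θ ∈ Icc (0 : ℝ) 1) (ψ : Z →L[ℂ] ℂ) {M₀ M₁ : ℝ}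
    (hM₀ : 0 ≤ M₀) (hM₁ : 0 ≤ M₁) (h₀ : ∀ a, ‖ψ (j₀ a)‖ ≤ M₀ * ‖a‖)
    (h₁ : ∀ b, ‖ψ (j₁ b)‖ ≤ M₁ * ‖b‖) {z : Z} (hz : z ∈ interpSpace j₀ j₁ θ) :
    ‖ψ z‖ ≤ M₀ ^ (1 - θ) * M₁ ^ θ * interpNorm j₀ j₁ θ z := by
  let Ψ : SumSpace j₀ j₁ →L[ℂ] ℂ :=
    ⟨ψ.toLinearMap ∘ₗ SumSpace.incl j₀ j₁, ψ.continuous.comp (SumSpace.continuous_incl j₀ j₁)⟩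
  have key (F : calderon j₀ j₁) (hF : evalAt j₀ j₁ θ F = z) :
      ‖ψ z‖ ≤ M₀ ^ (1 - θ) * M₁ ^ θ * max ‖F.1.2.1‖ ‖F.1.2.2‖ := by
    set m := max ‖F.1.2.1‖ ‖F.1.2.2‖ with hm
    have hm0 : 0 ≤ m := le_max_of_le_left (norm_nonneg _)
    have hC : IsCalderon j₀ j₁ F.1 := F.2
    have hstrip : closure (Complex.HadamardThreeLines.verticalStrip 0 1)
        = {z : ℂ | z.re ∈ Icc (0 : ℝ) 1} := by
      have : Complex.HadamardThreeLines.verticalStrip 0 1 = Complex.re ⁻¹' Ioo 0 1 := rfl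
      rw [this, Complex.closure_preimage_re, closure_Ioo zero_ne_one]
      rfl
    have hcl : DiffContOnCl ℂ (fun z => Ψ (F.1.1 z))
        (Complex.HadamardThreeLines.verticalStrip 0 1) := by
      refine ⟨Ψ.differentiable.comp_differentiableOn hC.differentiableOn, ?_⟩
      rw [hstrip]
      exact Ψ.continuous.comp_continuousOn hC.continuousOn
    have hbd : BddAbove ((norm ∘ fun z => Ψ (F.1.1 z)) ''
        Complex.HadamardThreeLines.verticalClosedStrip 0 1) := by
      obtain ⟨M, hM⟩ := hC.bounded
      refine ⟨‖Ψ‖ * M, ?_⟩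
      rintro _ ⟨w, hw, rfl⟩
      exact (Ψ.le_opNorm _).trans (mul_le_mul_of_nonneg_left (hM w hw) (norm_nonneg _))
    have hl (w : ℂ) (hw : w ∈ Complex.re ⁻¹' {0}) : ‖Ψ (F.1.1 w)‖ ≤ M₀ * m := by
      have hw' : w = w.im * Complex.I := by
        apply Complex.ext <;> simp_all
      rw [hw', hC.left]
      have : Ψ (SumSpace.inl j₀ j₁ (F.1.2.1 w.im)) = ψ (j₀ (F.1.2.1 w.im)) := by simp [Ψ]
      rw [this]
      refine (h₀ _).trans (mul_le_mul_of_nonneg_left ?_ hM₀)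
      exact (F.1.2.1.toBCF.norm_coe_le_norm w.im).trans (le_max_left _ _)
    have hr (w : ℂ) (hw : w ∈ Complex.re ⁻¹' {1}) : ‖Ψ (F.1.1 w)‖ ≤ M₁ * m := by
      have hw' : w = 1 + w.im * Complex.I := by
        apply Complex.ext <;> simp_all
      rw [hw', hC.right]
      have : Ψ (SumSpace.inr j₀ j₁ (F.1.2.2 w.im)) = ψ (j₁ (F.1.2.2 w.im)) := by simp [Ψ]
      rw [this]
      refine (h₁ _).trans (mul_le_mul_of_nonneg_left ?_ hM₁)
      exact (F.1.2.2.toBCF.norm_coe_le_norm w.im).trans (le_max_right _ _)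
    have := Complex.HadamardThreeLines.norm_le_interp_of_mem_verticalClosedStrip₀₁' _
      (z := (θ : ℂ)) (by simpa [Complex.HadamardThreeLines.verticalClosedStrip] using hθ)
      hcl hbd hl hr
    have hz' : Ψ (F.1.1 θ) = ψ z := by rw [← hF]; rfl
    rw [hz', Complex.ofReal_re, Real.mul_rpow hM₀ hm0, Real.mul_rpow hM₁ hm0] at this
    refine this.trans (le_of_eq ?_)
    -- Recombining `m ^ (1 - θ) * m ^ θ` into `m` by adding exponents needs `m > 0`; for `m = 0` the
    -- convention `0 ^ 0 = 1` makes `θ = 0` a separate case.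
    rcases hm0.eq_or_lt with h | h
    · rw [← h]
      rcases eq_or_ne θ 0 with rfl | h'
      · simp
      · simp [Real.zero_rpow h']
    · calc _ = M₀ ^ (1 - θ) * M₁ ^ θ * (m ^ (1 - θ) * m ^ θ) := by ring
        _ = _ := by rw [← Real.rpow_add h]; simp
  -- If the constant vanishes one cannot divide by it, but then any single representative already
  -- gives `ψ z = 0`.
  rcases (show 0 ≤ M₀ ^ (1 - θ) * M₁ ^ θ by positivity).eq_or_lt with h | h
  · obtain ⟨F, hF⟩ := hz
    simpa [← h] using key F hF
  · rw [← div_le_iff₀' h]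
    exact le_interpNorm hz fun F hF => (div_le_iff₀' h).2 (key F hF)

end ComplexInterpolation

namespace OperatorSpace

/-! ### Operator norms of matrices in terms of their rows and columns -/

section MatrixBounds

variable {H : Type*} [NormedAddCommGroup H] [InnerProductSpace ℂ H]
  {X : Submodule ℂ (H →L[ℂ] H)} {n : ℕ}

theorem OpMatrix.norm_le_of_sq_le (A : OpMatrix X n) {M : ℝ} (hM : 0 ≤ M)
    (h : ∀ ξ : Fin n → H, ∑ i, ‖∑ j, (A i j).1 (ξ j)‖ ^ 2 ≤ M ^ 2 * ∑ j, ‖ξ j‖ ^ 2) : ‖A‖ ≤ M := by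
  rw [OpMatrix.norm_def]
  refine ContinuousLinearMap.opNorm_le_bound _ hM fun ξ => ?_
  refine le_of_sq_le_sq ?_ (by positivity)
  rw [mul_pow, PiLp.norm_sq_eq_of_L2, PiLp.norm_sq_eq_of_L2]
  simp_rw [OpMatrix.toOperator_apply]
  exact h ξ

theorem OpMatrix.sq_le_norm_sq_mul (A : OpMatrix X n) (ξ : Fin n → H) :
    ∑ i, ‖∑ j, (A i j).1 (ξ j)‖ ^ 2 ≤ ‖A‖ ^ 2 * ∑ j, ‖ξ j‖ ^ 2 := by
  have h := (OpMatrix.toOperator A).le_opNorm (WithLp.toLp 2 ξ)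
  have := pow_le_pow_left₀ (norm_nonneg _) h 2
  rw [mul_pow, PiLp.norm_sq_eq_of_L2, PiLp.norm_sq_eq_of_L2] at this
  simp_rw [OpMatrix.toOperator_apply] at this
  exact this

theorem OpMatrix.norm_le_of_col (A : OpMatrix X n) (k : Fin n) (hA : ∀ i j, j ≠ k → A i j = 0)
    {M : ℝ} (hM : 0 ≤ M) (h : ∀ ξ : H, ∑ i, ‖(A i k).1 ξ‖ ^ 2 ≤ M ^ 2 * ‖ξ‖ ^ 2) : ‖A‖ ≤ M := by
  refine A.norm_le_of_sq_le hM fun ξ => ?_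
  have (i : Fin n) : ∑ j, (A i j).1 (ξ j) = (A i k).1 (ξ k) :=
    Finset.sum_eq_single k (fun j _ hj => by simp [hA i j hj]) (by simp)
  simp_rw [this]
  refine (h _).trans (mul_le_mul_of_nonneg_left ?_ (sq_nonneg M))
  exact Finset.single_le_sum (f := fun j => ‖ξ j‖ ^ 2) (fun _ _ => sq_nonneg _)
    (Finset.mem_univ k)

theorem OpMatrix.norm_le_of_row (A : OpMatrix X n) (k : Fin n) (hA : ∀ i j, i ≠ k → A i j = 0)
    {M : ℝ} (hM : 0 ≤ M)
    (h : ∀ ξ : Fin n → H, ‖∑ j, (A k j).1 (ξ j)‖ ^ 2 ≤ M ^ 2 * ∑ j, ‖ξ j‖ ^ 2) : ‖A‖ ≤ M := by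
  refine A.norm_le_of_sq_le hM fun ξ => ?_
  rw [Finset.sum_eq_single k _ (by simp)]
  · exact h ξ
  · intro i _ hi
    simp [hA i _ hi]

theorem OpMatrix.col_sq_le (A : OpMatrix X n) (k : Fin n) (ξ : H) :
    ∑ i, ‖(A i k).1 ξ‖ ^ 2 ≤ ‖A‖ ^ 2 * ‖ξ‖ ^ 2 := by
  have h := A.sq_le_norm_sq_mul (Pi.single k ξ)
  have h₁ (i : Fin n) : ∑ j, (A i j).1 (Pi.single (M := fun _ => H) k ξ j) = (A i k).1 ξ := by
    rw [Finset.sum_eq_single k (fun j _ hj => by simp [hj]) (by simp), Pi.single_eq_same]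
  have h₂ : ∑ j, ‖Pi.single (M := fun _ => H) k ξ j‖ ^ 2 = ‖ξ‖ ^ 2 := by
    rw [Finset.sum_eq_single k (fun j _ hj => by simp [hj]) (by simp), Pi.single_eq_same]
  simpa only [h₁, h₂] using h

theorem OpMatrix.row_sq_le (A : OpMatrix X n) (k : Fin n) (ξ : Fin n → H) :
    ‖∑ j, (A k j).1 (ξ j)‖ ^ 2 ≤ ‖A‖ ^ 2 * ∑ j, ‖ξ j‖ ^ 2 :=
  (Finset.single_le_sum (f := fun i => ‖∑ j, (A i j).1 (ξ j)‖ ^ 2) (fun _ _ => sq_nonneg _)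
    (Finset.mem_univ k)).trans (A.sq_le_norm_sq_mul ξ)

end MatrixBounds

/-! ### Row and column operators of a vector -/

theorem orthonormal_basisVec : Orthonormal ℂ basisVec := by
  rw [orthonormal_iff_ite]
  intro i j
  rw [basisVec, basisVec, lp.inner_single_left]
  by_cases h : i = j
  · subst h; simp
  · simp [h]

theorem norm_basisVec (j : ℕ) : ‖basisVec j‖ = 1 := orthonormal_basisVec.1 j

@[simp]
theorem star_basisVec (j : ℕ) : star (basisVec j) = basisVec j := by
  ext i
  rw [lp.star_apply, basisVec, lp.single_apply]
  by_cases h : i = j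
  · subst h; simp
  · simp [h]

/-- Used to see that the row and column operators of arbitrary vectors lie in the closed spans that
define `R` and `C`. -/
theorem map_mem_of_basisVec {F : Type*} [NormedAddCommGroup F] [NormedSpace ℂ F]
    (φ : Ell2 →L[ℂ] F) {S : Submodule ℂ F} (hS : IsClosed (S : Set F))
    (h : ∀ j, φ (basisVec j) ∈ S) (y : Ell2) : φ y ∈ S := by
  have hy : HasSum (fun i => lp.single 2 i (y i)) y := lp.hasSum_single ENNReal.ofNat_ne_top y
  refine hS.mem_of_tendsto (φ.hasSum hy) (Eventually.of_forall fun s => S.sum_mem fun i _ => ?_)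
  have : lp.single 2 i (y i) = y i • basisVec i := by
    rw [basisVec, ← lp.single_smul]
    simp
  rw [this, map_smul]
  exact S.smul_mem _ (h i)

/-- The row operator `ξ ↦ (∑ j, y_j ξ_j) e_0` of `y`. -/
def rowOp : Ell2 →L[ℂ] Ell2 →L[ℂ] Ell2 where
  toFun y := InnerProductSpace.rankOne ℂ (basisVec 0) (star y)
  map_add' x y := by simp
  map_smul' c x := by simp [star_smul]
  cont := (InnerProductSpace.rankOne ℂ (basisVec 0)).continuous.comp continuous_star

theorem rowOp_apply (y ξ : Ell2) : rowOp y ξ = inner ℂ (star y) ξ • basisVec 0 := rfl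

/-- The column operator `ξ ↦ ξ_0 y` of `y`. -/
def colOp : Ell2 →L[ℂ] Ell2 →L[ℂ] Ell2 :=
  (InnerProductSpace.rankOne ℂ).flip (basisVec 0)

theorem colOp_apply (y ξ : Ell2) : colOp y ξ = inner ℂ (basisVec 0) ξ • y := rfl

/-- The inverse of `rowEmb`. -/
def rowLift : Ell2 →L[ℂ] rowSpace :=
  rowOp.codRestrict rowSpace <| map_mem_of_basisVec rowOp
    (Submodule.isClosed_topologicalClosure _) fun j =>
      Submodule.le_topologicalClosure _ <| Submodule.subset_span ⟨j, by
        simp [matUnit, rowOp]⟩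

/-- The inverse of `colEmb`. -/
def colLift : Ell2 →L[ℂ] colSpace :=
  colOp.codRestrict colSpace <| map_mem_of_basisVec colOp
    (Submodule.isClosed_topologicalClosure _) fun j =>
      Submodule.le_topologicalClosure _ <| Submodule.subset_span ⟨j, rfl⟩

@[simp]
theorem coe_rowLift (y : Ell2) : (rowLift y).1 = rowOp y := rfl

@[simp]
theorem coe_colLift (y : Ell2) : (colLift y).1 = colOp y := rfl

@[simp]
theorem rowEmb_rowLift (y : Ell2) : rowEmb (rowLift y) = y := by
  have : rowEmb (rowLift y) = star (ContinuousLinearMap.adjoint (rowOp y) (basisVec 0)) := rfl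
  rw [this]
  have : rowOp y = InnerProductSpace.rankOne ℂ (basisVec 0) (star y) := rfl
  rw [this, InnerProductSpace.adjoint_rankOne, InnerProductSpace.rankOne_apply,
    inner_self_eq_norm_sq_to_K, norm_basisVec]
  simp

@[simp]
theorem colEmb_colLift (y : Ell2) : colEmb (colLift y) = y := by
  have : colEmb (colLift y) = colOp y (basisVec 0) := rfl
  rw [this, colOp_apply, inner_self_eq_norm_sq_to_K, norm_basisVec]
  simp

theorem norm_rowOp_apply (y ξ : Ell2) : ‖rowOp y ξ‖ = ‖inner ℂ (star y) ξ‖ := by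
  rw [rowOp_apply, norm_smul, norm_basisVec, mul_one]

theorem norm_rowOp_le (y ξ : Ell2) : ‖rowOp y ξ‖ ≤ ‖y‖ * ‖ξ‖ := by
  rw [norm_rowOp_apply]
  exact (norm_inner_le_norm _ _).trans_eq (by rw [norm_star])

theorem norm_colOp_le (y ξ : Ell2) : ‖colOp y ξ‖ ≤ ‖y‖ * ‖ξ‖ := by
  rw [colOp_apply, norm_smul, mul_comm]
  refine mul_le_mul_of_nonneg_left ?_ (norm_nonneg y)
  exact (norm_inner_le_norm _ _).trans_eq (by rw [norm_basisVec, one_mul])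

theorem norm_rowEmb_le (T : rowSpace) : ‖rowEmb T‖ ≤ ‖T‖ := by
  have : rowEmb T = star (ContinuousLinearMap.adjoint T.1 (basisVec 0)) := rfl
  rw [this, norm_star]
  refine (ContinuousLinearMap.le_opNorm _ _).trans ?_
  rw [norm_basisVec, mul_one, LinearIsometryEquiv.norm_map]
  rfl

theorem norm_colEmb_le (T : colSpace) : ‖colEmb T‖ ≤ ‖T‖ := by
  refine (T.1.le_opNorm (basisVec 0)).trans ?_
  rw [norm_basisVec, mul_one]
  rfl

/-! ### The matrix norms of `(R, C)_θ` on matrices over `ℓ₂` -/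

variable {n : ℕ}

/-- The norm of `M_n((R, C)_θ)`, as a function on matrices over `ℓ₂`. -/
abbrev rcNorm (θ : ℝ) (n : ℕ) (D : Matrix (Fin n) (Fin n) Ell2) : ℝ :=
  ComplexInterpolation.interpNorm (OpMatrix.amplify rowEmb n) (OpMatrix.amplify colEmb n) θ D

/-- A matrix over `ℓ₂`, seen in `M_n(R)`. -/
def rowMatrix (D : Matrix (Fin n) (Fin n) Ell2) : OpMatrix rowSpace n :=
  fun i j => rowLift (D i j)

/-- A matrix over `ℓ₂`, seen in `M_n(C)`. -/
def colMatrix (D : Matrix (Fin n) (Fin n) Ell2) : OpMatrix colSpace n :=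
  fun i j => colLift (D i j)

@[simp]
theorem amplify_rowMatrix (D : Matrix (Fin n) (Fin n) Ell2) :
    OpMatrix.amplify rowEmb n (rowMatrix D) = D :=
  Matrix.ext fun i j => rowEmb_rowLift (D i j)

@[simp]
theorem amplify_colMatrix (D : Matrix (Fin n) (Fin n) Ell2) :
    OpMatrix.amplify colEmb n (colMatrix D) = D :=
  Matrix.ext fun i j => colEmb_colLift (D i j)

theorem rowMatrix_smul (c : ℂ) (D : Matrix (Fin n) (Fin n) Ell2) :
    rowMatrix (c • D) = c • rowMatrix D :=
  Matrix.ext fun i j => map_smul rowLift c (D i j)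

theorem colMatrix_smul (c : ℂ) (D : Matrix (Fin n) (Fin n) Ell2) :
    colMatrix (c • D) = c • colMatrix D :=
  Matrix.ext fun i j => map_smul colLift c (D i j)

/-- Both endpoint spaces map onto all matrices over `ℓ₂`, so membership is never an obstruction. -/
theorem mem_interpSpace_matrix (θ : ℝ) (D : Matrix (Fin n) (Fin n) Ell2) :
    D ∈ ComplexInterpolation.interpSpace (OpMatrix.amplify rowEmb n)
      (OpMatrix.amplify colEmb n) θ := by
  have := ComplexInterpolation.mem_interpSpace_of_eq
    ((amplify_rowMatrix D).trans (amplify_colMatrix D).symm) θ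
  rwa [amplify_rowMatrix] at this

theorem mem_RC (θ : ℝ) (y : Ell2) : y ∈ RC θ := by
  have := ComplexInterpolation.mem_interpSpace_of_eq (E₀ := rowSpace) (E₁ := colSpace)
    (j₀ := rowEmb) (j₁ := colEmb)
    (a := rowLift y) (b := colLift y)
    ((rowEmb_rowLift y).trans (colEmb_colLift y).symm) θ
  rwa [rowEmb_rowLift] at this

theorem rcNorm_smul_le (θ : ℝ) (D : Matrix (Fin n) (Fin n) Ell2) (c : ℂ) {M₀ M₁ : ℝ}
    (hM₀ : 0 < M₀) (hM₁ : 0 < M₁) (h₀ : ‖rowMatrix D‖ ≤ M₀) (h₁ : ‖colMatrix D‖ ≤ M₁) :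
    rcNorm θ n (c • D) ≤ Real.exp 1 * (‖c‖ * (M₀ ^ (1 - θ) * M₁ ^ θ)) := by
  have := ComplexInterpolation.interpNorm_le_of_norm_le (K := ‖c‖)
    ((amplify_rowMatrix (c • D)).trans (amplify_colMatrix (c • D)).symm) θ hM₀ hM₁
    (by
      rw [rowMatrix_smul, norm_smul]
      exact mul_le_mul_of_nonneg_left h₀ (norm_nonneg c))
    (by
      rw [colMatrix_smul, norm_smul]
      exact mul_le_mul_of_nonneg_left h₁ (norm_nonneg c))
  rwa [amplify_rowMatrix] at this

/-- Bessel's inequality: the operator sends `ξ` to its coefficients along an orthonormal family. -/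
theorem norm_rowMatrix_col_le (v : Fin n → ℕ) (hv : Function.Injective v) (k : Fin n) :
    ‖rowMatrix (Matrix.updateCol 0 k fun i => basisVec (v i))‖ ≤ 1 := by
  refine OpMatrix.norm_le_of_col _ k (fun i j hj => ?_) zero_le_one fun ξ => ?_
  · simp [rowMatrix, hj]
  · have := (orthonormal_basisVec.comp v hv).sum_inner_products_le (s := Finset.univ) ξ
    simpa [rowMatrix, Matrix.updateCol_apply, norm_rowOp_apply] using this

/-- The images of the single entries point in orthogonal directions, so by Pythagoras their squared
norms add up. -/
theorem norm_colMatrix_row_le (v : Fin n → ℕ) (hv : Function.Injective v) (k : Fin n) :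
    ‖colMatrix (Matrix.updateRow 0 k fun i => basisVec (v i))‖ ≤ 1 := by
  refine OpMatrix.norm_le_of_row _ k (fun i j hi => ?_) zero_le_one fun ξ => ?_
  · simp [colMatrix, Matrix.updateRow_apply, hi]
  · have h₁ (j : Fin n) : (colMatrix (Matrix.updateRow 0 k fun i => basisVec (v i)) k j).1 (ξ j)
        = inner ℂ (basisVec 0) (ξ j) • basisVec (v j) := by
      simp [colMatrix, Matrix.updateRow_apply, colOp_apply]
    simp_rw [h₁]
    have h₂ := (orthonormal_basisVec.comp v hv).inner_sum
      (fun j => inner ℂ (basisVec 0) (ξ j)) (fun j => inner ℂ (basisVec 0) (ξ j)) Finset.univ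
    have h₃ : ‖∑ j, inner ℂ (basisVec 0) (ξ j) • basisVec (v j)‖ ^ 2
        = ∑ j, ‖inner ℂ (basisVec 0) (ξ j)‖ ^ 2 := by
      simp only [Function.comp_apply, inner_self_eq_norm_sq_to_K, RCLike.conj_mul] at h₂
      exact_mod_cast h₂
    rw [h₃, one_pow, one_mul]
    refine Finset.sum_le_sum fun j _ => pow_le_pow_left₀ (norm_nonneg _) ?_ 2
    exact (norm_inner_le_norm _ _).trans_eq (by rw [norm_basisVec, one_mul])

/-- Here no orthogonality is needed: a column of columns is one long column. With unit entries this
gives `M = √n`. -/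
theorem norm_colMatrix_col_le (v : Fin n → Ell2) (k : Fin n) {M : ℝ} (hM : 0 ≤ M)
    (hv : ∑ i, ‖v i‖ ^ 2 ≤ M ^ 2) : ‖colMatrix (Matrix.updateCol 0 k v)‖ ≤ M := by
  refine OpMatrix.norm_le_of_col _ k (fun i j hj => ?_) hM fun ξ => ?_
  · simp [colMatrix, hj]
  · refine le_trans ?_ (mul_le_mul_of_nonneg_right hv (sq_nonneg _))
    rw [Finset.sum_mul]
    refine Finset.sum_le_sum fun i _ => ?_
    rw [← mul_pow]
    refine pow_le_pow_left₀ (norm_nonneg _) ?_ 2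
    simpa [colMatrix, Matrix.updateCol_apply] using norm_colOp_le (v i) ξ

theorem norm_rowMatrix_row_le (v : Fin n → Ell2) (k : Fin n) {M : ℝ} (hM : 0 ≤ M)
    (hv : ∑ i, ‖v i‖ ^ 2 ≤ M ^ 2) : ‖rowMatrix (Matrix.updateRow 0 k v)‖ ≤ M := by
  refine OpMatrix.norm_le_of_row _ k (fun i j hi => ?_) hM fun ξ => ?_
  · simp [rowMatrix, Matrix.updateRow_apply, hi]
  · refine le_trans ?_ (mul_le_mul_of_nonneg_right hv (Finset.sum_nonneg fun _ _ => sq_nonneg _))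
    refine le_trans ?_ (Finset.sum_mul_sq_le_sq_mul_sq _ _ _)
    refine pow_le_pow_left₀ (norm_nonneg _) ((norm_sum_le _ _).trans ?_) 2
    refine Finset.sum_le_sum fun j _ => ?_
    simpa [rowMatrix, Matrix.updateRow_apply] using norm_rowOp_le (v j) (ξ j)

theorem rcNorm_smul_col_le (hn : 0 < n) (θ : ℝ) (v : Fin n → ℕ) (hv : Function.Injective v)
    (k : Fin n) (c : ℂ) :
    rcNorm θ n (c • Matrix.updateCol 0 k fun i => basisVec (v i))
      ≤ Real.exp 1 * (‖c‖ * √n ^ θ) := by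
  have hn' : 0 < √(n : ℝ) := Real.sqrt_pos.2 (by exact_mod_cast hn)
  simpa using rcNorm_smul_le θ _ c one_pos hn' (norm_rowMatrix_col_le v hv k)
    (norm_colMatrix_col_le _ k hn'.le (by simp [norm_basisVec]))

theorem rcNorm_smul_row_le (hn : 0 < n) (θ : ℝ) (v : Fin n → ℕ) (hv : Function.Injective v)
    (k : Fin n) (c : ℂ) :
    rcNorm θ n (c • Matrix.updateRow 0 k fun i => basisVec (v i))
      ≤ Real.exp 1 * (‖c‖ * √n ^ (1 - θ)) := by
  have hn' : 0 < √(n : ℝ) := Real.sqrt_pos.2 (by exact_mod_cast hn)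
  simpa using rcNorm_smul_le θ _ c hn' one_pos
    (norm_rowMatrix_row_le _ k hn'.le (by simp [norm_basisVec])) (norm_colMatrix_row_le v hv k)

/-- A matrix with a single non-zero entry. -/
theorem rcNorm_single_le (θ : ℝ) (k l : Fin n) (y : Ell2) :
    rcNorm θ n (Matrix.single k l y) ≤ Real.exp 1 * ‖y‖ := by
  have hc : Matrix.single k l y = Matrix.updateCol 0 l (Pi.single k y) := by
    refine Matrix.ext fun i j => ?_
    simp only [Matrix.updateCol_apply, Matrix.single_apply, Pi.single_apply, Matrix.zero_apply]
    grind
  have hr : Matrix.single k l y = Matrix.updateRow 0 k (Pi.single l y) := by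
    refine Matrix.ext fun i j => ?_
    simp only [Matrix.updateRow_apply, Matrix.single_apply, Pi.single_apply, Matrix.zero_apply]
    grind
  have hs (m : Fin n) : ∑ i, ‖Pi.single (M := fun _ => Ell2) m y i‖ ^ 2 ≤ ‖y‖ ^ 2 := by
    rw [Finset.sum_eq_single m (fun j _ hj => by simp [hj]) (by simp), Pi.single_eq_same]
  have := ComplexInterpolation.interpNorm_le_of_eq
    ((amplify_rowMatrix (Matrix.single k l y)).trans (amplify_colMatrix _).symm) θ 0 (M := ‖y‖)
    (by
      rw [zero_mul, neg_zero, Real.exp_zero, one_mul, hr]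
      exact norm_rowMatrix_row_le _ k (norm_nonneg y) (hs l))
    (by
      rw [zero_mul, Real.exp_zero, one_mul, hc]
      exact norm_colMatrix_col_le _ l (norm_nonneg y) (hs k))
  rwa [amplify_rowMatrix] at this

/-! ### Lower bounds -/

/-- The functional `D ↦ ∑ p, ⟪y_p, D_p⟫` over a family of positions `p`. -/
def pairing (pos : Fin n → Fin n × Fin n) (y : Fin n → Ell2) :
    Matrix (Fin n) (Fin n) Ell2 →L[ℂ] ℂ where
  toFun D := ∑ j, inner ℂ (y j) (D (pos j).1 (pos j).2)
  map_add' D E := by simp [Finset.sum_add_distrib]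
  map_smul' c D := by simp [Finset.mul_sum]
  cont := continuous_finsetSum _ fun j _ =>
    continuous_const.inner (continuous_id.matrix_elem (pos j).1 (pos j).2)

theorem pairing_apply (pos : Fin n → Fin n × Fin n) (y : Fin n → Ell2)
    (D : Matrix (Fin n) (Fin n) Ell2) :
    pairing pos y D = ∑ j, inner ℂ (y j) (D (pos j).1 (pos j).2) := rfl

theorem pairing_amplify {X : Submodule ℂ (Ell2 →L[ℂ] Ell2)} (u : X →L[ℂ] Ell2)
    (pos : Fin n → Fin n × Fin n) (y : Fin n → Ell2) (A : OpMatrix X n) :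
    pairing pos y (OpMatrix.amplify u n A)
      = ∑ j, inner ℂ (y j) (u (A (pos j).1 (pos j).2)) := rfl

theorem norm_sum_inner_le (y a : Fin n → Ell2) {N : ℝ} (hN : 0 ≤ N)
    (h : ∑ j, ‖a j‖ ^ 2 ≤ N ^ 2) :
    ‖∑ j, inner ℂ (y j) (a j)‖ ≤ √(∑ j, ‖y j‖ ^ 2) * N := by
  calc ‖∑ j, inner ℂ (y j) (a j)‖ ≤ ∑ j, ‖y j‖ * ‖a j‖ :=
        (norm_sum_le _ _).trans (Finset.sum_le_sum fun j _ => norm_inner_le_norm _ _)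
    _ ≤ √(∑ j, ‖y j‖ ^ 2) * √(∑ j, ‖a j‖ ^ 2) := Real.sum_mul_le_sqrt_mul_sqrt _ _ _
    _ ≤ _ := mul_le_mul_of_nonneg_left (Real.sqrt_le_iff.2 ⟨hN, h⟩) (Real.sqrt_nonneg _)

theorem norm_sum_inner_le_of_forall (y a : Fin n → Ell2) {N : ℝ} (hN : 0 ≤ N)
    (h : ∀ j, ‖a j‖ ≤ N) :
    ‖∑ j, inner ℂ (y j) (a j)‖ ≤ √n * √(∑ j, ‖y j‖ ^ 2) * N := by
  rw [mul_comm (√n), mul_assoc]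
  refine norm_sum_inner_le y a (by positivity) ?_
  rw [mul_pow, Real.sq_sqrt (Nat.cast_nonneg n)]
  calc ∑ j, ‖a j‖ ^ 2 ≤ ∑ _j : Fin n, N ^ 2 :=
        Finset.sum_le_sum fun j _ => pow_le_pow_left₀ (norm_nonneg _) (h j) 2
    _ = _ := by simp

/-- Testing the `k`-th row of `A` on the vectors `b j = (A k j)* e_0` gives `S ² ≤ ‖A‖ ² S`, where
`S` is the sum to be bounded. -/
theorem sum_sq_rowEmb_le (A : OpMatrix rowSpace n) (k : Fin n) :
    ∑ j, ‖rowEmb (A k j)‖ ^ 2 ≤ ‖A‖ ^ 2 := by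
  set b : Fin n → Ell2 := fun j => ContinuousLinearMap.adjoint (A k j).1 (basisVec 0) with hb
  have h₁ (j : Fin n) : ‖rowEmb (A k j)‖ = ‖b j‖ := norm_star (b j)
  simp_rw [h₁]
  set S := ∑ j, ‖b j‖ ^ 2 with hS
  have hS0 : 0 ≤ S := Finset.sum_nonneg fun _ _ => sq_nonneg _
  have h₂ : inner ℂ (basisVec 0) (∑ j, (A k j).1 (b j)) = (S : ℂ) := by
    rw [inner_sum, hS, Complex.ofReal_sum]
    refine Finset.sum_congr rfl fun j _ => ?_
    rw [← ContinuousLinearMap.adjoint_inner_left, inner_self_eq_norm_sq_to_K]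
    exact (Complex.ofReal_pow _ _).symm
  have h₃ : S ≤ ‖∑ j, (A k j).1 (b j)‖ := by
    have := norm_inner_le_norm (𝕜 := ℂ) (basisVec 0) (∑ j, (A k j).1 (b j))
    rwa [h₂, norm_basisVec, one_mul, Complex.norm_real, Real.norm_of_nonneg hS0] at this
  have h₄ := (pow_le_pow_left₀ hS0 h₃ 2).trans (A.row_sq_le k b)
  rcases hS0.eq_or_lt with h | h
  · rw [← h]
    positivity
  · rw [pow_two] at h₄
    exact le_of_mul_le_mul_right h₄ h

theorem sum_sq_colEmb_le (A : OpMatrix colSpace n) (k : Fin n) :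
    ∑ i, ‖colEmb (A i k)‖ ^ 2 ≤ ‖A‖ ^ 2 := by
  have := A.col_sq_le k (basisVec 0)
  rwa [norm_basisVec, one_pow, mul_one] at this

theorem norm_rowEmb_entry_le (A : OpMatrix rowSpace n) (i j : Fin n) :
    ‖rowEmb (A i j)‖ ≤ ‖A‖ :=
  (norm_rowEmb_le _).trans (A.norm_entry_le i j)

theorem norm_colEmb_entry_le (A : OpMatrix colSpace n) (i j : Fin n) :
    ‖colEmb (A i j)‖ ≤ ‖A‖ :=
  (norm_colEmb_le _).trans (A.norm_entry_le i j)

theorem rcNorm_nonneg (θ : ℝ) (D : Matrix (Fin n) (Fin n) Ell2) : 0 ≤ rcNorm θ n D :=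
  Real.iInf_nonneg fun _ => le_max_of_le_left (norm_nonneg _)

theorem norm_entry_le_rcNorm {θ : ℝ} (hθ : θ ∈ Icc (0 : ℝ) 1)
    (D : Matrix (Fin n) (Fin n) Ell2) (k l : Fin n) : ‖D k l‖ ≤ rcNorm θ n D := by
  -- `pairing` always sums `n` terms; `Pi.single` leaves only one of them, and the index `k` at
  -- which it sits is arbitrary.
  let ψ : Matrix (Fin n) (Fin n) Ell2 →L[ℂ] ℂ := pairing (fun _ => (k, l)) (Pi.single k (D k l))
  have hψ (E : Matrix (Fin n) (Fin n) Ell2) : ψ E = inner ℂ (D k l) (E k l) := by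
    simp only [ψ, pairing_apply]
    rw [Finset.sum_eq_single k (fun j _ hj => by simp [hj]) (by simp), Pi.single_eq_same]
  have h := ComplexInterpolation.norm_le_interpNorm hθ ψ (norm_nonneg (D k l))
    (norm_nonneg (D k l))
    (fun A => by
      rw [hψ]
      exact (norm_inner_le_norm _ _).trans
        (mul_le_mul_of_nonneg_left (norm_rowEmb_entry_le A k l) (norm_nonneg _)))
    (fun A => by
      rw [hψ]
      exact (norm_inner_le_norm _ _).trans
        (mul_le_mul_of_nonneg_left (norm_colEmb_entry_le A k l) (norm_nonneg _)))
    (mem_interpSpace_matrix θ D)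
  rcases (norm_nonneg (D k l)).eq_or_lt with h0 | h0
  · rw [← h0]
    exact rcNorm_nonneg θ D
  · rw [hψ, inner_self_eq_norm_sq_to_K, ← Real.rpow_add h0, sub_add_cancel, Real.rpow_one,
      norm_pow, pow_two] at h
    simp only [Complex.coe_algebraMap, Complex.norm_real, norm_norm] at h
    exact le_of_mul_le_mul_left h h0

theorem norm_pairing_self (pos : Fin n → Fin n × Fin n) (D : Matrix (Fin n) (Fin n) Ell2) :
    ‖pairing pos (fun j => D (pos j).1 (pos j).2) D‖
      = √(∑ j, ‖D (pos j).1 (pos j).2‖ ^ 2) * √(∑ j, ‖D (pos j).1 (pos j).2‖ ^ 2) := by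
  have h0 : 0 ≤ ∑ j, ‖D (pos j).1 (pos j).2‖ ^ 2 := Finset.sum_nonneg fun _ _ => sq_nonneg _
  rw [Real.mul_self_sqrt h0, pairing_apply]
  simp_rw [inner_self_eq_norm_sq_to_K]
  rw [← Real.norm_of_nonneg h0, ← Complex.norm_real]
  simp

theorem sqrt_le_sqrt_sum_sq (y : Fin n → Ell2) (h : ∀ j, 1 ≤ ‖y j‖) :
    √(n : ℝ) ≤ √(∑ j, ‖y j‖ ^ 2) := by
  refine Real.sqrt_le_sqrt ?_
  calc (n : ℝ) = ∑ _j : Fin n, (1 : ℝ) := by simp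
    _ ≤ _ := Finset.sum_le_sum fun j _ => one_le_pow₀ (h j)

/-- Duality: pairing with the `k`-th column of `D` itself, of `ℓ²`-length `Y`, is bounded by `Y` on
`M_n(C)`, where columns add in squares, and by `√n Y` on `M_n(R)`, where only the entrywise bound is
used. The value at `D` is `Y ²`. -/
theorem rpow_le_rcNorm_col (hn : 0 < n) {θ : ℝ} (hθ : θ ∈ Icc (0 : ℝ) 1)
    (D : Matrix (Fin n) (Fin n) Ell2) (k : Fin n) (h : ∀ i, 1 ≤ ‖D i k‖) :
    √n ^ θ ≤ rcNorm θ n D := by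
  have hq : 0 < √(n : ℝ) := Real.sqrt_pos.2 (by exact_mod_cast hn)
  set Y := √(∑ i, ‖D i k‖ ^ 2) with hY
  have hqY : √n ≤ Y := sqrt_le_sqrt_sum_sq _ h
  have hY0 : 0 < Y := hq.trans_le hqY
  have key := ComplexInterpolation.norm_le_interpNorm hθ
    (pairing (fun i => (i, k)) fun i => D i k) (M₀ := √n * Y) (M₁ := Y) (by positivity) hY0.le
    (fun A => by
      rw [pairing_amplify]
      exact norm_sum_inner_le_of_forall _ _ (norm_nonneg A) fun i => norm_rowEmb_entry_le A i k)
    (fun A => by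
      rw [pairing_amplify]
      exact norm_sum_inner_le _ _ (norm_nonneg A) (sum_sq_colEmb_le A k))
    (mem_interpSpace_matrix θ D)
  rw [norm_pairing_self (fun i => (i, k)) D, Real.mul_rpow hq.le hY0.le, mul_assoc (√n ^ (1 - θ)),
    ← Real.rpow_add hY0, sub_add_cancel, Real.rpow_one, mul_right_comm] at key
  -- Cancelling `Y` leaves `√n ≤ Y ≤ √n ^ (1 - θ) * rcNorm θ n D`.
  have h₁ := hqY.trans (le_of_mul_le_mul_right key hY0)
  rw [Real.rpow_sub hq, Real.rpow_one, div_mul_eq_mul_div, le_div_iff₀ (by positivity)] at h₁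
  exact le_of_mul_le_mul_left h₁ hq

theorem rpow_le_rcNorm_row (hn : 0 < n) {θ : ℝ} (hθ : θ ∈ Icc (0 : ℝ) 1)
    (D : Matrix (Fin n) (Fin n) Ell2) (k : Fin n) (h : ∀ j, 1 ≤ ‖D k j‖) :
    √n ^ (1 - θ) ≤ rcNorm θ n D := by
  have hq : 0 < √(n : ℝ) := Real.sqrt_pos.2 (by exact_mod_cast hn)
  set Y := √(∑ j, ‖D k j‖ ^ 2) with hY
  have hqY : √n ≤ Y := sqrt_le_sqrt_sum_sq _ h
  have hY0 : 0 < Y := hq.trans_le hqY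
  have key := ComplexInterpolation.norm_le_interpNorm hθ
    (pairing (fun j => (k, j)) fun j => D k j) (M₀ := Y) (M₁ := √n * Y) hY0.le (by positivity)
    (fun A => by
      rw [pairing_amplify]
      exact norm_sum_inner_le _ _ (norm_nonneg A) (sum_sq_rowEmb_le A k))
    (fun A => by
      rw [pairing_amplify]
      exact norm_sum_inner_le_of_forall _ _ (norm_nonneg A) fun j => norm_colEmb_entry_le A k j)
    (mem_interpSpace_matrix θ D)
  rw [norm_pairing_self (fun j => (k, j)) D, Real.mul_rpow hq.le hY0.le, mul_left_comm,
    ← Real.rpow_add hY0, sub_add_cancel, Real.rpow_one, mul_right_comm] at key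
  have h₁ := hqY.trans (le_of_mul_le_mul_right key hY0)
  rw [Real.rpow_sub hq, Real.rpow_one, div_le_iff₀ (by positivity), mul_comm]
  exact h₁

end OperatorSpace

/-! ### Real-valued bounds extracted from the coarse moduli -/

namespace Coarse

variable {ι : Type*} {A B : ι → Type*} {dA : ∀ i, A i → A i → ℝ} {dB : ∀ i, B i → B i → ℝ}
  {S : ∀ i, Set (A i)} {f : ∀ i, A i → B i}

theorem IsEquiCoarseEmbedding.exists_expansion_le (h : IsEquiCoarseEmbedding dA dB S f) {t : ℝ}
    (ht : 0 ≤ t) :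
    ∃ L : ℝ, 0 ≤ L ∧
      ∀ i, ∀ x ∈ S i, ∀ y ∈ S i, dA i x y ≤ t → dB i (f i x) (f i y) ≤ L := by
  refine ⟨(expansionModulus dA dB S f t).toReal, ENNReal.toReal_nonneg, ?_⟩
  intro i x hx y hy hxy
  refine (ENNReal.ofReal_le_iff_le_toReal (h.1 t ht).ne).1 ?_
  exact le_iSup_of_le i <| le_iSup₂_of_le x hx <| le_iSup₂_of_le y hy <|
    le_iSup_of_le hxy le_rfl

theorem IsEquiCoarseEmbedding.exists_le_compression (h : IsEquiCoarseEmbedding dA dB S f) (c : ℝ) :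
    ∃ t : ℝ, 0 < t ∧
      ∀ i, ∀ x ∈ S i, ∀ y ∈ S i, t ≤ dA i x y → c ≤ dB i (f i x) (f i y) := by
  have h₁ : ∀ᶠ t in atTop, ENNReal.ofReal c < compressionModulus dA dB S f t :=
    h.2.eventually (lt_mem_nhds ENNReal.ofReal_lt_top)
  obtain ⟨t, ht, ht0⟩ := (h₁.and (eventually_gt_atTop 0)).exists
  refine ⟨t, ht0, fun i x hx y hy hxy => ?_⟩
  have h₂ : compressionModulus dA dB S f t ≤ ENNReal.ofReal (dB i (f i x) (f i y)) :=
    iInf_le_of_le i <| iInf₂_le_of_le x hx <| iInf₂_le_of_le y hy <| iInf_le_of_le hxy le_rfl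
  exact le_of_lt (lt_of_not_ge fun hle =>
    (ht.trans_le h₂).not_ge (ENNReal.ofReal_le_ofReal hle))

end Coarse

/-! ### The path argument against an embedding -/

namespace OperatorSpace

/-- A vector of `ℓ₂` as an element of `(R, C)_θ`. -/
def toRC (θ : ℝ) (y : Ell2) : RC θ := ⟨y, mem_RC θ y⟩

/-- If the matrices `x n` with entries `0` or of norm `1` satisfy `‖x n‖ ≲ n ^ (α / 2)` in
`M_n((R, C)_θ)`, and if every matrix whose entries have norm at least `1` on the support of `x n`
has norm at least `n ^ (β / 2)` in `M_n((R, C)_γ)` for some `β > α`, then the bounded subsets of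
`(R, C)_θ` do not almost completely coarsely embed into `(R, C)_γ`. -/
theorem not_embed_of_growth {θ γ α β : ℝ} (hθ : θ ∈ Icc (0 : ℝ) 1)
    (hα₀ : 0 ≤ α) (hα₁ : α ≤ 1) (hαβ : α < β) (x : ∀ n : ℕ+, Matrix (Fin n) (Fin n) Ell2)
    (hx₁ : ∀ n i j, x n i j ≠ 0 → ‖x n i j‖ = 1)
    (hx : ∀ (n : ℕ+) (c : ℂ), rcNorm θ n (c • x n) ≤ Real.exp 1 * (‖c‖ * √n ^ α))
    (hD : ∀ (n : ℕ+) (D : Matrix (Fin n) (Fin n) Ell2),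
      (∀ i j, x n i j ≠ 0 → 1 ≤ ‖D i j‖) → √n ^ β ≤ rcNorm γ n D) :
    ¬ BoundedSubsetsAlmostCompletelyCoarselyEmbed (rcNorms θ) (rcNorms γ) := by
  rintro ⟨f, hf⟩
  obtain ⟨L, hL0, hL⟩ := hf.exists_expansion_le zero_le_one
  -- The threshold `e` compensates the factor `e` in `rcNorm_single_le`, so that single entries are
  -- moved by at least `1`.
  obtain ⟨t, ht0, ht⟩ := hf.exists_le_compression (Real.exp 1)
  set g : ℕ+ → Ell2 → Ell2 := fun n y => (f n (toRC θ y) : Ell2) with hg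
  replace hL (n : ℕ+) (y z : Matrix (Fin n) (Fin n) Ell2) (hy : rcNorm θ n y ≤ n)
      (hz : rcNorm θ n z ≤ n) (hyz : rcNorm θ n (y - z) ≤ 1) :
      rcNorm γ n (y.map (g n) - z.map (g n)) ≤ L :=
    hL n (y.map (toRC θ)) hy (z.map (toRC θ)) hz hyz
  replace ht (n : ℕ+) (y z : Matrix (Fin n) (Fin n) Ell2) (hy : rcNorm θ n y ≤ n)
      (hz : rcNorm θ n z ≤ n) (hyz : t ≤ rcNorm θ n (y - z)) :
      Real.exp 1 ≤ rcNorm γ n (y.map (g n) - z.map (g n)) :=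
    ht n (y.map (toRC θ)) hy (z.map (toRC θ)) hz hyz
  have hzero (n : ℕ+) : rcNorm θ n (0 : Matrix (Fin n) (Fin n) Ell2) ≤ n :=
    (ComplexInterpolation.interpNorm_zero_le θ).trans (Nat.cast_nonneg _)
  -- on vectors of norm `t`, the maps stay away from their value at `0`
  have hentry (n : ℕ+) (hn : Real.exp 1 * t ≤ n) (u : Ell2) (hu : ‖u‖ = 1) :
      1 ≤ ‖g n ((t : ℂ) • u) - g n 0‖ := by
    set k : Fin n := ⟨0, n.pos⟩
    have htu : ‖(t : ℂ) • u‖ = t := by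
      rw [norm_smul, hu, mul_one, Complex.norm_real, Real.norm_of_nonneg ht0.le]
    have h₁ := ht n (Matrix.single k k ((t : ℂ) • u)) 0
      ((rcNorm_single_le θ k k _).trans (by rwa [htu])) (hzero n)
      (by
        rw [sub_zero]
        have := norm_entry_le_rcNorm hθ (Matrix.single k k ((t : ℂ) • u)) k k
        rwa [Matrix.single_apply_same, htu] at this)
    have h₂ : (Matrix.single k k ((t : ℂ) • u)).map (g n) - Matrix.map 0 (g n)
        = Matrix.single k k (g n ((t : ℂ) • u) - g n 0) := by
      refine Matrix.ext fun i j => ?_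
      by_cases h : k = i ∧ k = j
      · obtain ⟨rfl, rfl⟩ := h
        simp
      · simp [h]
    rw [h₂] at h₁
    exact le_of_mul_le_mul_left (by simpa using h₁.trans (rcNorm_single_le γ k k _))
      (Real.exp_pos 1)
  -- the resulting bounds for `x n`
  have hmain (n : ℕ+) (hn : Real.exp 1 * t ≤ √n) :
      √n ^ β ≤ (Real.exp 1 * t + 2) * L * √n ^ α := by
    have hq1 : 1 ≤ √(n : ℝ) := Real.one_le_sqrt.2 (by exact_mod_cast n.pos)
    have hqn : √(n : ℝ) * √n = n := Real.mul_self_sqrt (Nat.cast_nonneg _)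
    have hqa : √(n : ℝ) ^ α ≤ √n := by
      simpa using Real.rpow_le_rpow_of_exponent_le hq1 hα₁
    have hqa1 : 1 ≤ √(n : ℝ) ^ α := Real.one_le_rpow hq1 hα₀
    -- `s` bounds the norm of `t • x n`. As `α ≤ 1` and `e t ≤ √n`, it is at most `n`, so the whole
    -- segment from `0` stays in the ball of radius `n`.
    set s : ℝ := Real.exp 1 * (t * √n ^ α) with hs
    have hs0 : 0 ≤ s := by positivity
    have hsn : s ≤ n := by
      rw [← hqn, hs, ← mul_assoc]
      exact mul_le_mul hn hqa (by positivity) (Real.sqrt_nonneg _)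
    -- The number of steps: `K ≥ s` makes each of norm at most `1`, and the extra `1` makes `K`
    -- visibly positive.
    set K : ℕ := ⌈s⌉₊ + 1 with hK
    have hKs : s ≤ K := by
      rw [hK]
      push_cast
      linarith [Nat.le_ceil s]
    have hKs' : (K : ℝ) ≤ s + 2 := by
      rw [hK]
      push_cast
      linarith [Nat.ceil_lt_add_one hs0]
    have hK0 : (0 : ℝ) < K := by positivity
    have hnorm (r : ℝ) (hr : 0 ≤ r) : rcNorm θ n (((r * t : ℝ) : ℂ) • x n) ≤ r * s := by
      refine (hx n _).trans_eq ?_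
      rw [Complex.norm_real, Real.norm_of_nonneg (by positivity), hs]
      ring
    have hball (k : ℕ) (hk : k ≤ K) : rcNorm θ n (((k / K * t : ℝ) : ℂ) • x n) ≤ n := by
      refine (hnorm (k / K) (by positivity)).trans (le_trans ?_ hsn)
      refine mul_le_of_le_one_left hs0 ((div_le_one hK0).2 (by exact_mod_cast hk))
    have hpath (k : ℕ) (hk : k ≤ K) :
        rcNorm γ n ((((k / K * t : ℝ) : ℂ) • x n).map (g n) - Matrix.map 0 (g n)) ≤ k * L := by
      induction k with
      | zero =>
        simpa using ComplexInterpolation.interpNorm_zero_le γ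
      | succ k ih =>
        have h₁ := hL n _ _ (hball (k + 1) hk) (hball k (by omega)) (by
          rw [← sub_smul, ← Complex.ofReal_sub]
          have : ((k + 1 : ℕ) / K * t - k / K * t : ℝ) = 1 / K * t := by
            push_cast
            ring
          rw [this]
          refine (hnorm (1 / K) (by positivity)).trans ?_
          rw [one_div_mul_eq_div]
          exact (div_le_one hK0).2 hKs)
        have h₂ := ComplexInterpolation.interpNorm_add_le
          (mem_interpSpace_matrix γ
            (((((k + 1 : ℕ) / K * t : ℝ) : ℂ) • x n).map (g n)
              - (((k / K * t : ℝ) : ℂ) • x n).map (g n)))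
          (mem_interpSpace_matrix γ
            ((((k / K * t : ℝ) : ℂ) • x n).map (g n) - Matrix.map 0 (g n)))
        rw [sub_add_sub_cancel] at h₂
        refine h₂.trans ((add_le_add h₁ (ih (by omega))).trans_eq ?_)
        push_cast
        ring
    have h₁ := hpath K le_rfl
    rw [div_self hK0.ne', one_mul] at h₁
    have hn' : Real.exp 1 * t ≤ n := hn.trans (by nlinarith)
    -- At the end of the path every entry in the support of `x n` has been moved by at least `1`;
    -- off the support nothing is required.
    have h₂ := hD n _ fun i j hij => hentry n hn' (x n i j) (hx₁ n i j hij)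
    calc √(n : ℝ) ^ β ≤ K * L := h₂.trans h₁
      _ ≤ (s + 2) * L := mul_le_mul_of_nonneg_right hKs' hL0
      _ ≤ (s + 2 * √n ^ α) * L := mul_le_mul_of_nonneg_right (by linarith) hL0
      _ = _ := by rw [hs]; ring
  have hsqrt : Tendsto (fun n : ℕ => √(n : ℝ)) atTop atTop :=
    Real.tendsto_sqrt_atTop.comp tendsto_natCast_atTop_atTop
  -- Since `β > α`, the quotient `√n ^ β / √n ^ α` outgrows the constant, which does not depend on
  -- `n`.
  have hlim := (tendsto_rpow_atTop (sub_pos.2 hαβ)).comp hsqrt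
  obtain ⟨n, ⟨h₁, h₂⟩, h₃⟩ := ((hsqrt.eventually_ge_atTop (Real.exp 1 * t)).and
    (hlim.eventually_gt_atTop ((Real.exp 1 * t + 2) * L))).and (eventually_gt_atTop 0) |>.exists
  have h₄ := hmain ⟨n, h₃⟩ h₁
  have hq : 0 < √(n : ℝ) := Real.sqrt_pos.2 (by exact_mod_cast h₃)
  simp only [Function.comp_apply, Real.rpow_sub hq, lt_div_iff₀ (Real.rpow_pos_of_pos hq α)] at h₂
  exact h₂.not_ge h₄

end OperatorSpace

end

/-! ### Conclusion: columns or rows, according to the order of the parameters -/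

open OperatorSpace

theorem mainTheorem1 (θ γ : ℝ) (hθ : θ ∈ Set.Icc (0 : ℝ) 1) (hγ : γ ∈ Set.Icc (0 : ℝ) 1)
    (hne : θ ≠ γ) :
    ¬ OperatorSpace.BoundedSubsetsAlmostCompletelyCoarselyEmbed
        (OperatorSpace.rcNorms θ) (OperatorSpace.rcNorms γ) := by
  have hb (j : ℕ) : basisVec j ≠ 0 := norm_ne_zero_iff.1 (by simp [norm_basisVec])
  rcases hne.lt_or_gt with h | h
  -- For `θ < γ`, columns, with exponents `α = θ` and `β = γ`.
  · refine not_embed_of_growth hθ hθ.1 hθ.2 h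
      (fun n => Matrix.updateCol 0 ⟨0, n.pos⟩ fun i => basisVec i) (fun n i j hij => ?_)
      (fun n c => rcNorm_smul_col_le n.pos θ _ Fin.val_injective _ c)
      fun n D hD => rpow_le_rcNorm_col n.pos hγ D ⟨0, n.pos⟩ fun i => hD i _ ?_
    · rw [Matrix.updateCol_apply] at hij ⊢
      split_ifs at hij ⊢ with hj
      · exact norm_basisVec _
      · exact absurd rfl hij
    · rw [Matrix.updateCol_self]
      exact hb i
  -- For `γ < θ`, rows, with exponents `α = 1 - θ` and `β = 1 - γ`.
  · refine not_embed_of_growth hθ (sub_nonneg.2 hθ.2) (sub_le_self 1 hθ.1)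
      (sub_lt_sub_left h 1)
      (fun n => Matrix.updateRow 0 ⟨0, n.pos⟩ fun i => basisVec i) (fun n i j hij => ?_)
      (fun n c => rcNorm_smul_row_le n.pos θ _ Fin.val_injective _ c)
      fun n D hD => rpow_le_rcNorm_row n.pos hγ D ⟨0, n.pos⟩ fun i => hD _ i ?_
    · rw [Matrix.updateRow_apply] at hij ⊢
      split_ifs at hij ⊢ with hj
      · exact norm_basisVec _
      · exact absurd rfl hij
    · rw [Matrix.updateRow_self]
      exact hb i
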